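/- **Theorem (ZeroTrainingError).** Let $d,M\in\mathbb{N}$ and let $(x^{(i)},y^{(i)})_{i=1}^M\subset\mathbb{R}^d\times\mathbb{R}$ be a data set whose inputs are in distinct directions: every $x^{(i)}$ is nonzero, and no two of them with different indices lie on the same line through the origin. Put $\pi=\frac1M\sum_{i=1}^M\delta_{(x^{(i)},y^{(i)})}$ and $\hat Y=(y^{(1)},\dots,y^{(M)})$. Let $\sigma\in C^2_b(\mathbb{R})$ (that is, $\sigma$ is twice continuously differentiable and $\sigma,\sigma',\sigma''$ are bounded) be non-polynomial and slowly increasing, i.e. $\lim_{t\to\infty}\sigma(t)/t^{a}=0$ for every $a>0$. Let $B>0$ and let $\mu_0(dc,dw)$ be a probability measure on $\mathbb{R}\times\mathbb{R}^d$ which is carried by $[-B,B]\times\mathbb{R}^d$ and satisfies $\mu_0(\Gamma)>0$ for every measurable $\Gamma\subset[-B,B]\times\mathbb{R}^d$ of positive Lebesgue measure. Let $\alpha>0$, and let $\mathcal{G}$ be a random vector in $\mathbb{R}^M$ with an arbitrary law (for instance the Gaussian law of the network output at initialization in the infinite-width limit). Consider the random limit equation of the regression problem, for $t\ge 0$ and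 $x\in\{x^{(1)},\dots,x^{(M)}\}$, \begin{align*} h_t(x)={}&h_0(x)+\alpha\int_0^t\int (y-h_s(x'))\,\langle \sigma(w\cdot x)\sigma(w\cdot x'),\mu_0\rangle\,\pi(dx',dy)\,ds\\ &+\alpha\int_0^t\int (y-h_s(x'))\,\langle c^2\sigma'(w\cdot x')\sigma'(w\cdot x)\,x\cdot x',\mu_0\rangle\,\pi(dx',dy)\,ds,\\ h_0(x^{(i)})={}&\mathcal{G}_i , \end{align*} where $\langle f,\mu_0\rangle=\int f(c,w)\,\mu_0(dc,dw)$. Almost surely this equation has a solution on $[0,\infty)$ that is continuous in $t$ (and $h_t(x^{(i)})$ can be chosen as a random variable for every $t\ge 0$ and every $i$), the solution is unique, and $$h_t=(h_t(x^{(1)}),\dots,h_t(x^{(M)}))\to\hat Y\qquad\text{as }t\to\infty .$$ In particular the training error $\int (y-h_t(x))^2\,\pi(dx,dy)$ tends to $0$, its global minimum. -/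

import Mathlib

open MeasureTheory Filter Topology Set

noncomputable section

namespace XavierRegression

/-- The class `C_b²(ℝ)`: twice continuously differentiable functions that are bounded together
with their first two derivatives. -/
def IsC2b (σ : ℝ → ℝ) : Prop :=
  ContDiff ℝ 2 σ ∧ ∀ k : ℕ, k ≤ 2 → ∃ K : ℝ, ∀ t : ℝ, |iteratedDeriv k σ t| ≤ K

/-- `σ` does not coincide with a polynomial function. -/
def IsNonPolynomial (σ : ℝ → ℝ) : Prop :=
  ¬ ∃ p : Polynomial ℝ, ∀ t : ℝ, σ t = p.eval t

/-- `σ` is slowly increasing: `σ(t) / t ^ a → 0` as `t → ∞`, for every real `a > 0`. -/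
def IsSlowlyIncreasing (σ : ℝ → ℝ) : Prop :=
  ∀ a : ℝ, 0 < a → Tendsto (fun t : ℝ => σ t / t ^ a) atTop (𝓝 0)

/-- `μ₀`, a law of the parameters `(c, w) ∈ ℝ × ℝᵈ`, is carried by `[-B, B] × ℝᵈ` and charges
every subset of `[-B, B] × ℝᵈ` of positive Lebesgue measure. -/
def HasFullSupportOnStrip {d : ℕ} (B : ℝ) (μ₀ : Measure (ℝ × EuclideanSpace ℝ (Fin d))) : Prop :=
  (∀ᵐ p ∂μ₀, p.1 ∈ Icc (-B) B) ∧
  ∀ Γ : Set (ℝ × EuclideanSpace ℝ (Fin d)), MeasurableSet Γ → Γ ⊆ Icc (-B) B ×ˢ univ →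
    0 < volume Γ → 0 < μ₀ Γ

/-- The vectors `x i` are in distinct directions: they are nonzero and no two of them lie on the
same line through the origin. -/
def InDistinctDirections {d M : ℕ} (x : Fin M → EuclideanSpace ℝ (Fin d)) : Prop :=
  (∀ i, x i ≠ 0) ∧ ∀ i j, i ≠ j → ∀ c : ℝ, x i ≠ c • x j

/-- The empirical distribution `π = (1/M) ∑ᵢ δ_{(xᵢ, yᵢ)}` of the data set. -/
def dataMeasure {d M : ℕ} (x : Fin M → EuclideanSpace ℝ (Fin d)) (y : Fin M → ℝ) :
    Measure (EuclideanSpace ℝ (Fin d) × ℝ) :=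
  (M : ENNReal)⁻¹ • ∑ i : Fin M, Measure.dirac (x i, y i)

/-- `⟨σ(w·x) σ(w·x'), μ₀⟩`. -/
def outerKernel {d : ℕ} (σ : ℝ → ℝ) (μ₀ : Measure (ℝ × EuclideanSpace ℝ (Fin d)))
    (x x' : EuclideanSpace ℝ (Fin d)) : ℝ :=
  ∫ p, σ (inner ℝ p.2 x) * σ (inner ℝ p.2 x') ∂μ₀

/-- `⟨c² σ'(w·x') σ'(w·x) x·x', μ₀⟩`. -/
def innerKernel {d : ℕ} (σ : ℝ → ℝ) (μ₀ : Measure (ℝ × EuclideanSpace ℝ (Fin d)))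
    (x x' : EuclideanSpace ℝ (Fin d)) : ℝ :=
  ∫ p, p.1 ^ 2 * deriv σ (inner ℝ p.2 x') * deriv σ (inner ℝ p.2 x) * inner ℝ x x' ∂μ₀

/-- `h : t ↦ h_t` is a solution on `[0, ∞)`, continuous in time, of the limit equation of the
regression problem with initial value `g`. The unknown `h_t` is a function on the set of inputs
`{x₁, …, x_M}`; values elsewhere and for negative `t` are irrelevant. -/
structure IsLimitSolution {d M : ℕ} (σ : ℝ → ℝ) (α : ℝ)
    (μ₀ : Measure (ℝ × EuclideanSpace ℝ (Fin d)))
    (x : Fin M → EuclideanSpace ℝ (Fin d)) (y : Fin M → ℝ)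
    (g : Fin M → ℝ) (h : ℝ → EuclideanSpace ℝ (Fin d) → ℝ) : Prop where
  continuousOn : ∀ i, ContinuousOn (fun t => h t (x i)) (Ici 0)
  initial : ∀ i, h 0 (x i) = g i
  equation : ∀ t : ℝ, 0 ≤ t → ∀ i,
    h t (x i) = h 0 (x i)
      + α * (∫ s in (0 : ℝ)..t,
          ∫ z, (z.2 - h s z.1) * outerKernel σ μ₀ (x i) z.1 ∂(dataMeasure x y))
      + α * (∫ s in (0 : ℝ)..t,
          ∫ z, (z.2 - h s z.1) * innerKernel σ μ₀ (x i) z.1 ∂(dataMeasure x y))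

end XavierRegression

end

/-! On the inputs the equation is the linear system `h' = -(α/M) A (h - Ŷ)`, where `A` is the sum of
the two kernel matrices. Everything reduces to `A` being positive definite (`kernelMatrix_pos`). The
inner kernel is a Gram matrix, hence nonnegative. The outer form is `∫ (∑ vᵢ σ(w·xᵢ))² dμ₀`. If it
vanishes, full support and continuity give `∑ vᵢ σ(w·xᵢ) = 0` for all `w`, and `ridge_profile_const`
makes each `vᵢ σ` constant, so `v = 0`. Compactness then yields coercivity, and `energy_decay` gives
both uniqueness and convergence; existence comes from the matrix exponential. -/

namespace XavierRegression

/-! ### Linear independence of bounded ridge functions. -/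

section RidgeFunctions

variable {E : Type*} [NormedAddCommGroup E] [InnerProductSpace ℝ E]

/-- A bounded function whose increments by `h` do not depend on the base point is `h`-periodic. -/
theorem eq_of_bounded_of_increment_const {g : ℝ → ℝ} {K h k : ℝ} (hK : ∀ t, |g t| ≤ K)
    (hg : ∀ t, g (t + h) - g t = k) (t : ℝ) : g (t + h) = g t := by
  have key : ∀ n : ℕ, g (t + n * h) = g t + n * k := by
    intro n
    induction n with
    | zero => simp
    | succ n ih =>
      have := hg (t + n * h)
      have e : t + ((n + 1 : ℕ) : ℝ) * h = t + n * h + h := by push_cast; ring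
      rw [e]; push_cast; linarith
  have hk : k = 0 := by
    by_contra hk
    -- With this `n`, the `n`-step increment `n * k` exceeds the maximal oscillation `2 * K`.
    obtain ⟨n, hn⟩ := exists_nat_gt (2 * K / |k|)
    rw [div_lt_iff₀ (abs_pos.2 hk)] at hn
    have h1 : (n : ℝ) * |k| = |g (t + n * h) - g t| := by
      rw [key n, add_sub_cancel_left, abs_mul, Nat.abs_cast]
    have h2 := abs_sub (g (t + n * h)) (g t)
    linarith [hK (t + n * h), hK t]
  linarith [hg t]

/-- Two vectors in distinct directions are separated by a vector orthogonal to the second one. -/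
theorem exists_inner_eq_zero_inner_ne_zero {a b : E} (h : ∀ c : ℝ, a ≠ c • b) :
    ∃ v : E, inner ℝ v b = 0 ∧ inner ℝ v a ≠ 0 := by
  have hb : a ∉ Submodule.span ℝ {b} := by
    rw [Submodule.mem_span_singleton]
    rintro ⟨c, hc⟩
    exact h c hc.symm
  by_contra! hcon
  apply hb
  rw [← Submodule.orthogonal_orthogonal (Submodule.span ℝ {b}), Submodule.mem_orthogonal]
  intro v hv
  exact hcon v (Submodule.mem_orthogonal_singleton_iff_inner_left.1 hv)

/-- If a sum of bounded ridge functions in distinct directions vanishes identically, then each of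
their profiles is constant. -/
theorem ridge_profile_const {ι : Type*} [DecidableEq ι] (x : ι → E) (hx0 : ∀ i, x i ≠ 0)
    (hx : ∀ i j, i ≠ j → ∀ c : ℝ, x i ≠ c • x j) (s : Finset ι) :
    ∀ g : ι → ℝ → ℝ, (∀ i ∈ s, ∃ K, ∀ t, |g i t| ≤ K) →
      (∀ w : E, ∑ i ∈ s, g i (inner ℝ w (x i)) = 0) →
      ∀ i ∈ s, ∀ t, g i t = g i 0 := by
  induction s using Finset.induction_on with
  | empty => simp
  | insert j s hj ih =>
    intro g hb hsum
    have hs : ∀ i ∈ s, ∀ t, g i t = g i 0 := by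
      intro i hi t
      have hij : i ≠ j := fun h => hj (h ▸ hi)
      obtain ⟨v, hv, hvi⟩ := exists_inner_eq_zero_inner_ne_zero (hx i j hij)
      -- Moving `w` by `r • v` fixes the argument of the `j`-th profile and shifts that of the
      -- `i`-th by exactly `t`. Subtracting the two identities removes `j`, so the induction
      -- hypothesis applies to the increments.
      set r : ℝ := t / inner ℝ v (x i) with hr
      have hdiff := ih (fun i τ => g i (τ + r * inner ℝ v (x i)) - g i τ) ?_ ?_ i hi
      · obtain ⟨K, hK⟩ := hb i (Finset.mem_insert_of_mem hi)
        have := eq_of_bounded_of_increment_const hK hdiff 0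
        rwa [zero_add, hr, div_mul_cancel₀ _ hvi] at this
      · intro i hi
        obtain ⟨K, hK⟩ := hb i (Finset.mem_insert_of_mem hi)
        exact ⟨K + K, fun τ => (abs_sub _ _).trans (add_le_add (hK _) (hK _))⟩
      · intro w
        have h1 := hsum (w + r • v)
        have h2 := hsum w
        rw [Finset.sum_insert hj] at h1 h2
        simp only [inner_add_left, real_inner_smul_left, hv, mul_zero, add_zero] at h1
        rw [Finset.sum_sub_distrib]
        linarith
    intro i hi t
    rcases Finset.mem_insert.1 hi with rfl | hi
    · have hn : inner ℝ (x i) (x i) ≠ 0 := inner_self_ne_zero.2 (hx0 i)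
      -- The other profiles are already constant, so comparing this `w`, whose `j`-th argument is
      -- `t`, with `w = 0` isolates the new one.
      have h1 := hsum ((t / inner ℝ (x i) (x i)) • x i)
      have h2 := hsum 0
      rw [Finset.sum_insert hj, real_inner_smul_left, div_mul_cancel₀ _ hn,
        Finset.sum_congr rfl fun k hk => hs k hk _] at h1
      rw [Finset.sum_insert hj, inner_zero_left, Finset.sum_congr rfl fun k hk => hs k hk _] at h2
      linarith
    · exact hs i hi t

end RidgeFunctions

/-! ### Full support and integrability of the kernels. -/

section Kernels

variable {d M : ℕ} {σ : ℝ → ℝ} {μ₀ : Measure (ℝ × EuclideanSpace ℝ (Fin d))} {B : ℝ}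

theorem IsC2b.continuous (hσ : IsC2b σ) : Continuous σ := hσ.1.continuous

theorem IsC2b.continuous_deriv (hσ : IsC2b σ) : Continuous (deriv σ) :=
  hσ.1.continuous_deriv (by norm_num)

theorem IsC2b.bounded (hσ : IsC2b σ) : ∃ K, ∀ t, |σ t| ≤ K := by
  simpa using hσ.2 0 (by norm_num)

theorem IsC2b.bounded_deriv (hσ : IsC2b σ) : ∃ K, ∀ t, |deriv σ t| ≤ K := by
  simpa [iteratedDeriv_one] using hσ.2 1 (by norm_num)

/-- A continuous function of `w` that vanishes `μ₀`-almost everywhere vanishes identically. -/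
theorem HasFullSupportOnStrip.eq_zero_of_ae (hB : 0 < B) (hμ₀ : HasFullSupportOnStrip B μ₀)
    {F : EuclideanSpace ℝ (Fin d) → ℝ} (hF : Continuous F) (h0 : ∀ᵐ p ∂μ₀, F p.2 = 0) (w) :
    F w = 0 := by
  by_contra hw
  have hU : IsOpen {v | F v ≠ 0} := isOpen_ne_fun hF continuous_const
  have hpos : 0 < μ₀ (Ioo (-B) B ×ˢ {v | F v ≠ 0}) := by
    refine hμ₀.2 _ (measurableSet_Ioo.prod hU.measurableSet)
      (prod_mono Ioo_subset_Icc_self (subset_univ _)) ?_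
    exact (isOpen_Ioo.prod hU).measure_pos _ ⟨(0, w), ⟨by simpa using hB, hw⟩⟩
  refine hpos.ne' (measure_mono_null ?_ (ae_iff.1 h0))
  exact fun p hp => hp.2

theorem integrable_outerKernel [IsFiniteMeasure μ₀] (hσ : IsC2b σ)
    (x x' : EuclideanSpace ℝ (Fin d)) :
    Integrable (fun p : ℝ × EuclideanSpace ℝ (Fin d) =>
      σ (inner ℝ p.2 x) * σ (inner ℝ p.2 x')) μ₀ := by
  obtain ⟨K, hK⟩ := hσ.bounded
  have hc := hσ.continuous
  refine Integrable.of_bound (C := K * K) (by fun_prop) (.of_forall fun p => ?_)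
  rw [Real.norm_eq_abs, abs_mul]
  exact mul_le_mul (hK _) (hK _) (abs_nonneg _) ((abs_nonneg _).trans (hK 0))

theorem integrable_innerKernel [IsFiniteMeasure μ₀] (hσ : IsC2b σ)
    (hμ₀ : HasFullSupportOnStrip B μ₀) (x x' : EuclideanSpace ℝ (Fin d)) :
    Integrable (fun p : ℝ × EuclideanSpace ℝ (Fin d) =>
      p.1 ^ 2 * deriv σ (inner ℝ p.2 x') * deriv σ (inner ℝ p.2 x) * inner ℝ x x') μ₀ := by
  obtain ⟨K, hK⟩ := hσ.bounded_deriv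
  have hc := hσ.continuous_deriv
  have hK0 : 0 ≤ K := (abs_nonneg _).trans (hK 0)
  refine Integrable.of_bound (C := B ^ 2 * K * K * |inner ℝ x x'|)
    (by fun_prop) (hμ₀.1.mono fun p hp => ?_)
  rw [Real.norm_eq_abs, abs_mul, abs_mul, abs_mul, abs_of_nonneg (sq_nonneg p.1)]
  have : p.1 ^ 2 ≤ B ^ 2 := sq_le_sq' hp.1 hp.2
  gcongr
  · exact hK _
  · exact hK _

end Kernels

/-! ### Positive definiteness of the kernel matrix. -/

section KernelMatrix

variable {d M : ℕ} {σ : ℝ → ℝ} {μ₀ : Measure (ℝ × EuclideanSpace ℝ (Fin d))} {B : ℝ}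

/-- The matrix of the limit equation. -/
noncomputable def kernelMatrix (σ : ℝ → ℝ) (μ₀ : Measure (ℝ × EuclideanSpace ℝ (Fin d)))
    (x : Fin M → EuclideanSpace ℝ (Fin d)) : Matrix (Fin M) (Fin M) ℝ :=
  .of fun i j => outerKernel σ μ₀ (x i) (x j) + innerKernel σ μ₀ (x i) (x j)

theorem sum_mul_integral {X : Type*} [MeasurableSpace X] {μ : Measure X}
    {f : Fin M → Fin M → X → ℝ} (hf : ∀ i j, Integrable (f i j) μ) (v : Fin M → ℝ) :
    ∑ i, ∑ j, v i * v j * ∫ p, f i j p ∂μ = ∫ p, ∑ i, ∑ j, v i * v j * f i j p ∂μ := by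
  rw [integral_finsetSum _ fun i _ => integrable_finsetSum _ fun j _ => (hf i j).const_mul _]
  refine Finset.sum_congr rfl fun i _ => ?_
  rw [integral_finsetSum _ fun j _ => (hf i j).const_mul _]
  exact Finset.sum_congr rfl fun j _ => (integral_const_mul _ _).symm

theorem sum_outerKernel_pos [IsFiniteMeasure μ₀] (hσ : IsC2b σ) (hσ_np : IsNonPolynomial σ)
    (hB : 0 < B) (hμ₀ : HasFullSupportOnStrip B μ₀) {x : Fin M → EuclideanSpace ℝ (Fin d)}
    (hx : InDistinctDirections x) {v : Fin M → ℝ} (hv : v ≠ 0) :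
    0 < ∑ i, ∑ j, v i * v j * outerKernel σ μ₀ (x i) (x j) := by
  have hint := fun i j => integrable_outerKernel (μ₀ := μ₀) hσ (x i) (x j)
  have hsq : ∀ p : ℝ × EuclideanSpace ℝ (Fin d),
      ∑ i, ∑ j, v i * v j * (σ (inner ℝ p.2 (x i)) * σ (inner ℝ p.2 (x j))) =
        (∑ i, v i * σ (inner ℝ p.2 (x i))) ^ 2 := by
    intro p
    rw [sq, Finset.sum_mul_sum]
    exact Finset.sum_congr rfl fun i _ => Finset.sum_congr rfl fun j _ => by ring
  have hI : Integrable (fun p : ℝ × EuclideanSpace ℝ (Fin d) =>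
      (∑ i, v i * σ (inner ℝ p.2 (x i))) ^ 2) μ₀ := by
    simp only [← hsq]
    exact integrable_finsetSum _ fun i _ => integrable_finsetSum _ fun j _ =>
      (hint i j).const_mul _
  simp only [outerKernel]
  rw [sum_mul_integral hint, integral_congr_ae (.of_forall hsq)]
  refine (integral_nonneg fun p => sq_nonneg _).lt_of_ne' fun h0 => hv ?_
  rw [integral_eq_zero_iff_of_nonneg (fun p => sq_nonneg _) hI] at h0
  have hc := hσ.continuous
  have hzero := hμ₀.eq_zero_of_ae hB (F := fun w => ∑ i, v i * σ (inner ℝ w (x i)))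
    (by fun_prop) (h0.mono fun p hp => by simpa using hp)
  obtain ⟨K, hK⟩ := hσ.bounded
  have hconst := ridge_profile_const x hx.1 hx.2 Finset.univ (fun i t => v i * σ t)
    (fun i _ => ⟨|v i| * K, fun t => by rw [abs_mul]; gcongr; exact hK t⟩) hzero
  funext i
  by_contra hvi
  -- Dividing by `v i ≠ 0` shows that `σ` is constant, hence a polynomial.
  exact hσ_np ⟨.C (σ 0), fun t => by
    simpa using mul_left_cancel₀ hvi (hconst i (Finset.mem_univ i) t)⟩

/-- The integrand is `c² ‖∑ vᵢ σ'(w·xᵢ) xᵢ‖²`. -/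
theorem sum_innerKernel_nonneg [IsFiniteMeasure μ₀] (hσ : IsC2b σ)
    (hμ₀ : HasFullSupportOnStrip B μ₀) (x : Fin M → EuclideanSpace ℝ (Fin d)) (v : Fin M → ℝ) :
    0 ≤ ∑ i, ∑ j, v i * v j * innerKernel σ μ₀ (x i) (x j) := by
  simp only [innerKernel]
  rw [sum_mul_integral fun i j => integrable_innerKernel hσ hμ₀ (x i) (x j)]
  refine integral_nonneg fun p => ?_
  have : ∑ i, ∑ j, v i * v j * (p.1 ^ 2 * deriv σ (inner ℝ p.2 (x j)) *
      deriv σ (inner ℝ p.2 (x i)) * inner ℝ (x i) (x j)) =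
      p.1 ^ 2 * inner ℝ (∑ i, (v i * deriv σ (inner ℝ p.2 (x i))) • x i)
        (∑ i, (v i * deriv σ (inner ℝ p.2 (x i))) • x i) := by
    simp only [sum_inner, inner_sum, real_inner_smul_left, real_inner_smul_right, Finset.mul_sum]
    exact Finset.sum_congr rfl fun i _ => Finset.sum_congr rfl fun j _ => by
      rw [real_inner_comm (x i) (x j)]; ring
  simp only [this]
  exact mul_nonneg (sq_nonneg _) real_inner_self_nonneg

open Matrix in
theorem kernelMatrix_pos [IsFiniteMeasure μ₀] (hσ : IsC2b σ) (hσ_np : IsNonPolynomial σ)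
    (hB : 0 < B) (hμ₀ : HasFullSupportOnStrip B μ₀) {x : Fin M → EuclideanSpace ℝ (Fin d)}
    (hx : InDistinctDirections x) {v : Fin M → ℝ} (hv : v ≠ 0) :
    0 < v ⬝ᵥ kernelMatrix σ μ₀ x *ᵥ v := by
  have h := add_pos_of_pos_of_nonneg (sum_outerKernel_pos hσ hσ_np hB hμ₀ hx hv)
    (sum_innerKernel_nonneg hσ hμ₀ x v)
  rw [← Finset.sum_add_distrib] at h
  refine h.trans_eq ?_
  simp only [dotProduct, mulVec, kernelMatrix, of_apply, Finset.mul_sum]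
  refine Finset.sum_congr rfl fun i _ => ?_
  rw [← Finset.sum_add_distrib]
  exact Finset.sum_congr rfl fun j _ => by ring

end KernelMatrix

/-! ### Coercivity and exponential decay. -/

section LinearFlow

open Matrix

variable {M : ℕ}

/-- The quadratic form attains a positive minimum on the compact unit sphere, and homogeneity
extends the bound to all vectors. -/
theorem exists_coercive {A : Matrix (Fin M) (Fin M) ℝ} (hA : ∀ v, v ≠ 0 → 0 < v ⬝ᵥ A *ᵥ v) :
    ∃ c > 0, ∀ v, c * (v ⬝ᵥ v) ≤ v ⬝ᵥ A *ᵥ v := by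
  have hcont : Continuous fun v : Fin M → ℝ => v ⬝ᵥ A *ᵥ v := by fun_prop
  -- The sphere is empty exactly when `M = 0`.
  obtain hS | hS := (Metric.sphere (0 : Fin M → ℝ) 1).eq_empty_or_nonempty
  · refine ⟨1, one_pos, fun v => ?_⟩
    have : v = 0 := by
      by_contra hv
      refine (hS ▸ notMem_empty (‖v‖⁻¹ • v) : ‖v‖⁻¹ • v ∉ Metric.sphere (0 : Fin M → ℝ) 1) ?_
      simp [norm_smul, hv]
    simp [this]
  obtain ⟨v₀, hv₀, hmin⟩ := (isCompact_sphere (0 : Fin M → ℝ) 1).exists_isMinOn hS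
    hcont.continuousOn
  set m := v₀ ⬝ᵥ A *ᵥ v₀
  have hm : 0 < m := hA v₀ fun h => by simp [h] at hv₀
  -- The norm is the sup norm, so `v ⬝ᵥ v ≤ M ‖v‖²`; using `M + 1` keeps the denominator visibly
  -- positive.
  refine ⟨m / (M + 1), by positivity, fun v => ?_⟩
  have h1 : v ⬝ᵥ v ≤ (M + 1) * ‖v‖ ^ 2 := by
    calc v ⬝ᵥ v ≤ ∑ _i : Fin M, ‖v‖ ^ 2 := by
          refine Finset.sum_le_sum fun i _ => ?_
          rw [← sq, ← sq_abs]
          gcongr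
          exact norm_le_pi_norm v i
      _ ≤ _ := by
          rw [Finset.sum_const, Finset.card_univ, Fintype.card_fin, nsmul_eq_mul]
          nlinarith [sq_nonneg ‖v‖]
  have h2 : m * ‖v‖ ^ 2 ≤ v ⬝ᵥ A *ᵥ v := by
    by_cases hv : v = 0
    · simp [hv]
    have hn : 0 < ‖v‖ := norm_pos_iff.2 hv
    have := hmin (show ‖v‖⁻¹ • v ∈ Metric.sphere (0 : Fin M → ℝ) 1 by simp [norm_smul, hv])
    simp only [mem_ofPred_eq, mulVec_smul, dotProduct_smul, smul_dotProduct, smul_eq_mul] at this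
    change m ≤ _ at this
    calc m * ‖v‖ ^ 2 ≤ (‖v‖⁻¹ * (‖v‖⁻¹ * v ⬝ᵥ A *ᵥ v)) * ‖v‖ ^ 2 := by gcongr
      _ = _ := by field_simp
  calc m / (M + 1) * (v ⬝ᵥ v) ≤ m / (M + 1) * ((M + 1) * ‖v‖ ^ 2) := by gcongr
    _ = m * ‖v‖ ^ 2 := by field_simp
    _ ≤ _ := h2

/-- Exponential decay of the energy along the flow `u' = -b A u` of a coercive matrix. -/
theorem energy_decay {A : Matrix (Fin M) (Fin M) ℝ} {b c : ℝ} (hb : 0 ≤ b)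
    (hc : ∀ v, c * (v ⬝ᵥ v) ≤ v ⬝ᵥ A *ᵥ v) {u : ℝ → Fin M → ℝ}
    (hu : ∀ i, ContinuousOn (fun t => u t i) (Ici 0))
    (hu' : ∀ t, 0 < t → ∀ i, HasDerivAt (fun s => u s i) (-(b * (A *ᵥ u t) i)) t)
    {t : ℝ} (ht : 0 ≤ t) :
    u t ⬝ᵥ u t ≤ Real.exp (-(2 * b * c * t)) * (u 0 ⬝ᵥ u 0) := by
  have hd : ∀ t, 0 < t → HasDerivAt (fun s => Real.exp (2 * b * c * s) * (u s ⬝ᵥ u s))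
      (Real.exp (2 * b * c * t) * (2 * b * c) * (u t ⬝ᵥ u t) +
        Real.exp (2 * b * c * t) * -(2 * b * (u t ⬝ᵥ A *ᵥ u t))) t := by
    intro t ht
    have h1 : HasDerivAt (fun s => u s ⬝ᵥ u s) (-(2 * b * (u t ⬝ᵥ A *ᵥ u t))) t := by
      refine (HasDerivAt.fun_sum (u := Finset.univ)
        fun i _ => (hu' t ht i).fun_mul (hu' t ht i)).congr_deriv ?_
      rw [dotProduct, Finset.mul_sum, ← Finset.sum_neg_distrib]
      exact Finset.sum_congr rfl fun i _ => by ring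
    have h2 : HasDerivAt (fun s => Real.exp (2 * b * c * s))
        (Real.exp (2 * b * c * t) * (2 * b * c)) t := by
      simpa using ((hasDerivAt_id t).const_mul (2 * b * c)).exp
    exact h2.fun_mul h1
  -- Coercivity makes the derivative of the weighted energy nonpositive for `t > 0`; continuity
  -- covers the endpoint `0`.
  have hanti : AntitoneOn (fun s => Real.exp (2 * b * c * s) * (u s ⬝ᵥ u s)) (Ici 0) := by
    refine antitoneOn_of_deriv_nonpos (convex_Ici 0) ?_ ?_ ?_
    · refine ContinuousOn.mul (by fun_prop) ?_
      exact continuousOn_finsetSum _ fun i _ => (hu i).mul (hu i)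
    · rw [interior_Ici]
      exact fun s hs => (hd s hs).differentiableAt.differentiableWithinAt
    · rw [interior_Ici]
      intro s hs
      rw [(hd s hs).deriv]
      have h3 := mul_nonneg hb (sub_nonneg.2 (hc (u s)))
      nlinarith [mul_nonneg (Real.exp_pos (2 * b * c * s)).le h3]
  have := hanti (mem_Ici.2 le_rfl) (mem_Ici.2 ht) ht
  simp only [mul_zero, Real.exp_zero, one_mul] at this
  rw [Real.exp_neg, inv_mul_eq_div, le_div_iff₀ (Real.exp_pos _)]
  linarith

end LinearFlow

/-! ### The limit equation as a linear system. -/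

section LimitEquation

open Matrix

variable {d M : ℕ} {σ : ℝ → ℝ} {α : ℝ} {μ₀ : Measure (ℝ × EuclideanSpace ℝ (Fin d))} {B : ℝ}
  {x : Fin M → EuclideanSpace ℝ (Fin d)} {y : Fin M → ℝ} {g : Fin M → ℝ}

theorem InDistinctDirections.injective (hx : InDistinctDirections x) : Function.Injective x := by
  intro i j hij
  by_contra h
  exact hx.2 i j h 1 (by simpa using hij)

theorem integral_dataMeasure (f : EuclideanSpace ℝ (Fin d) × ℝ → ℝ) :
    ∫ z, f z ∂(dataMeasure x y) = (M : ℝ)⁻¹ * ∑ i, f (x i, y i) := by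
  rw [dataMeasure, integral_smul_measure,
    integral_finsetSum_measure fun i _ => integrable_dirac (by simp)]
  simp

theorem integral_drift (k : EuclideanSpace ℝ (Fin d) → ℝ) (f : EuclideanSpace ℝ (Fin d) → ℝ) :
    ∫ z, (z.2 - f z.1) * k z.1 ∂(dataMeasure x y) =
      (M : ℝ)⁻¹ * ∑ j, (y j - f (x j)) * k (x j) :=
  integral_dataMeasure _

theorem drift_add (f : EuclideanSpace ℝ (Fin d) → ℝ) (i : Fin M) :
    α * ((M : ℝ)⁻¹ * ∑ j, (y j - f (x j)) * outerKernel σ μ₀ (x i) (x j)) +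
      α * ((M : ℝ)⁻¹ * ∑ j, (y j - f (x j)) * innerKernel σ μ₀ (x i) (x j)) =
    -(α * (M : ℝ)⁻¹ * (kernelMatrix σ μ₀ x *ᵥ fun j => f (x j) - y j) i) := by
  simp only [mulVec, dotProduct, kernelMatrix, of_apply]
  rw [← mul_add, ← mul_add, ← Finset.sum_add_distrib, ← mul_assoc, ← mul_neg,
    ← Finset.sum_neg_distrib]
  exact congrArg _ (Finset.sum_congr rfl fun j _ => by ring)

/-- Integrals against `π` are finite averages, and continuity in time allows the two time integrals
to be merged into one. -/
theorem isLimitSolution_iff {h : ℝ → EuclideanSpace ℝ (Fin d) → ℝ} :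
    IsLimitSolution σ α μ₀ x y g h ↔
      (∀ i, ContinuousOn (fun t => h t (x i)) (Ici 0)) ∧ (∀ i, h 0 (x i) = g i) ∧
      ∀ t : ℝ, 0 ≤ t → ∀ i, h t (x i) = h 0 (x i) + ∫ s in (0 : ℝ)..t,
        -(α * (M : ℝ)⁻¹ * (kernelMatrix σ μ₀ x *ᵥ fun j => h s (x j) - y j) i) := by
  have key : (∀ i, ContinuousOn (fun t => h t (x i)) (Ici 0)) → ∀ t : ℝ, 0 ≤ t → ∀ i,
      α * (∫ s in (0 : ℝ)..t,
          ∫ z, (z.2 - h s z.1) * outerKernel σ μ₀ (x i) z.1 ∂(dataMeasure x y))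
      + α * (∫ s in (0 : ℝ)..t,
          ∫ z, (z.2 - h s z.1) * innerKernel σ μ₀ (x i) z.1 ∂(dataMeasure x y)) =
      ∫ s in (0 : ℝ)..t,
        -(α * (M : ℝ)⁻¹ * (kernelMatrix σ μ₀ x *ᵥ fun j => h s (x j) - y j) i) := by
    intro hc t ht i
    have hint : ∀ k : EuclideanSpace ℝ (Fin d) → ℝ, IntervalIntegrable
        (fun s => α * ((M : ℝ)⁻¹ * ∑ j, (y j - h s (x j)) * k (x j))) volume 0 t := by
      intro k
      refine ContinuousOn.intervalIntegrable_of_Icc ht (ContinuousOn.mono ?_ Icc_subset_Ici_self)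
      exact .mul continuousOn_const <| .mul continuousOn_const <| continuousOn_finsetSum _
        fun j _ => (continuousOn_const.sub (hc j)).mul continuousOn_const
    simp only [fun s (k : EuclideanSpace ℝ (Fin d) → ℝ) =>
      integral_drift (x := x) (y := y) k (h s)]
    rw [← intervalIntegral.integral_const_mul, ← intervalIntegral.integral_const_mul,
      ← intervalIntegral.integral_add (hint _) (hint _)]
    simp only [drift_add]
  constructor
  · rintro ⟨hc, h0, he⟩
    exact ⟨hc, h0, fun t ht i => by rw [he t ht i, add_assoc, key hc t ht i]⟩
  · rintro ⟨hc, h0, he⟩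
    exact ⟨hc, h0, fun t ht i => by rw [add_assoc, key hc t ht i, he t ht i]⟩

theorem IsLimitSolution.hasDerivAt {h : ℝ → EuclideanSpace ℝ (Fin d) → ℝ}
    (hh : IsLimitSolution σ α μ₀ x y g h) {t : ℝ} (ht : 0 < t) (i : Fin M) :
    HasDerivAt (fun s => h s (x i))
      (-(α * (M : ℝ)⁻¹ * (kernelMatrix σ μ₀ x *ᵥ fun j => h t (x j) - y j) i)) t := by
  obtain ⟨hc, -, he⟩ := isLimitSolution_iff.1 hh
  set F : ℝ → ℝ := fun s =>
    -(α * (M : ℝ)⁻¹ * (kernelMatrix σ μ₀ x *ᵥ fun j => h s (x j) - y j) i) with hF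
  have hFc : ContinuousOn F (Ici 0) := by
    refine (ContinuousOn.mul continuousOn_const ?_).neg
    simp only [mulVec, dotProduct]
    exact continuousOn_finsetSum _ fun j _ =>
      continuousOn_const.fun_mul ((hc j).fun_sub continuousOn_const)
  have hFt : ContinuousOn F (Ioi 0) := hFc.mono Ioi_subset_Ici_self
  have h1 : HasDerivAt (fun u => ∫ s in (0 : ℝ)..u, F s) (F t) t :=
    intervalIntegral.integral_hasDerivAt_right
      ((hFc.mono Icc_subset_Ici_self).intervalIntegrable_of_Icc ht.le)
      (hFt.stronglyMeasurableAtFilter isOpen_Ioi t ht) (hFt.continuousAt (Ioi_mem_nhds ht))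
  refine (h1.const_add (h 0 (x i))).congr_of_eventuallyEq ?_
  filter_upwards [Ioi_mem_nhds ht] with s hs using he s (le_of_lt hs) i

/-- The explicit flow `y + exp(tT)(g - y)` is continuous in `g`, which later yields measurability in
`ω`. -/
theorem exists_limitSolution (hx : InDistinctDirections x) (σ : ℝ → ℝ) (α : ℝ)
    (μ₀ : Measure (ℝ × EuclideanSpace ℝ (Fin d))) (y : Fin M → ℝ) :
    ∃ Φ : ℝ → (Fin M → ℝ) → EuclideanSpace ℝ (Fin d) → ℝ,
      (∀ t i, Continuous fun g => Φ t g (x i)) ∧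
      ∀ g, IsLimitSolution σ α μ₀ x y g fun t => Φ t g := by
  let T : (Fin M → ℝ) →L[ℝ] (Fin M → ℝ) :=
    LinearMap.toContinuousLinearMap (-((α * (M : ℝ)⁻¹) • (kernelMatrix σ μ₀ x).mulVecLin))
  let u : ℝ → (Fin M → ℝ) → Fin M → ℝ := fun t g => y + NormedSpace.exp (t • T) (g - y)
  have hu : ∀ g t, HasDerivAt (fun s => u s g) (T (u t g - y)) t := by
    intro g t
    have := (hasDerivAt_exp_smul_const' T t).clm_apply (hasDerivAt_const t (g - y))
    simpa [u] using this.const_add y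
  have hui : ∀ g t i, HasDerivAt (fun s => u s g i)
      (-(α * (M : ℝ)⁻¹ * (kernelMatrix σ μ₀ x *ᵥ fun j => u t g j - y j) i)) t := by
    intro g t i
    exact hasDerivAt_pi.1 (hu g t) i
  have huc : ∀ g i, Continuous fun t => u t g i := fun g i =>
    continuous_iff_continuousAt.2 fun t => (hui g t i).continuousAt
  -- Distinct inputs make it possible to prescribe values on them; elsewhere the value is `0`.
  refine ⟨fun t g => Function.extend x (u t g) 0, fun t i => ?_, fun g => ?_⟩
  · simp only [hx.injective.extend_apply]
    fun_prop
  · rw [isLimitSolution_iff]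
    simp only [hx.injective.extend_apply]
    refine ⟨fun i => (huc g i).continuousOn, fun i => by simp [u], fun t _ i => ?_⟩
    rw [intervalIntegral.integral_eq_sub_of_hasDerivAt (fun s _ => hui g s i)]
    · ring
    · refine Continuous.intervalIntegrable (continuous_const.mul ?_).neg _ _
      simp only [mulVec, dotProduct]
      exact continuous_finsetSum _ fun j _ =>
        continuous_const.fun_mul ((huc g j).fun_sub continuous_const)

/-- The difference of two solutions follows the homogeneous flow from `0`, so its energy stays `0`.
-/
theorem IsLimitSolution.unique {c : ℝ} (hα : 0 < α)
    (hA : ∀ v, c * (v ⬝ᵥ v) ≤ v ⬝ᵥ kernelMatrix σ μ₀ x *ᵥ v)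
    {h h' : ℝ → EuclideanSpace ℝ (Fin d) → ℝ}
    (hh : IsLimitSolution σ α μ₀ x y g h) (hh' : IsLimitSolution σ α μ₀ x y g h')
    {t : ℝ} (ht : 0 ≤ t) (i : Fin M) : h t (x i) = h' t (x i) := by
  have hE := energy_decay (b := α * (M : ℝ)⁻¹) (by positivity) hA
    (u := fun t i => h t (x i) - h' t (x i))
    (fun i => (hh.continuousOn i).sub (hh'.continuousOn i)) ?_ ht
  · have h0 : (fun i => h 0 (x i) - h' 0 (x i)) = 0 := by
      funext i; simp [hh.initial, hh'.initial]
    rw [h0, zero_dotProduct, mul_zero] at hE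
    have := dotProduct_self_eq_zero.1
      (le_antisymm hE (Finset.sum_nonneg fun i _ => mul_self_nonneg _))
    exact sub_eq_zero.1 (congrFun this i)
  · intro t ht i
    refine ((hh.hasDerivAt ht i).sub (hh'.hasDerivAt ht i)).congr_deriv ?_
    have hsub : (fun j => h t (x j) - h' t (x j)) =
        (fun j => h t (x j) - y j) - fun j => h' t (x j) - y j := by
      funext j; simp
    rw [hsub, mulVec_sub, Pi.sub_apply]
    ring

/-- The residual `h - y` follows the homogeneous flow, with decay rate `2αc/M > 0`. -/
theorem IsLimitSolution.tendsto {c : ℝ} (hα : 0 < α)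
    (hA : ∀ v, c * (v ⬝ᵥ v) ≤ v ⬝ᵥ kernelMatrix σ μ₀ x *ᵥ v)
    (hM : 0 < M) (hc : 0 < c)
    {h : ℝ → EuclideanSpace ℝ (Fin d) → ℝ} (hh : IsLimitSolution σ α μ₀ x y g h) :
    Tendsto (fun t => ∑ i, (y i - h t (x i)) ^ 2) atTop (𝓝 0) := by
  set b := α * (M : ℝ)⁻¹ with hb
  have hbp : 0 < b := by positivity
  set u : ℝ → Fin M → ℝ := fun t i => h t (x i) - y i
  have hlim : Tendsto (fun t => Real.exp (-(2 * b * c * t)) * (u 0 ⬝ᵥ u 0)) atTop (𝓝 0) := by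
    have := Real.tendsto_exp_neg_atTop_nhds_zero.comp
      (tendsto_id.const_mul_atTop (show 0 < 2 * b * c by positivity))
    simpa using this.mul_const (u 0 ⬝ᵥ u 0)
  refine squeeze_zero' (.of_forall fun t => Finset.sum_nonneg fun i _ => sq_nonneg _) ?_ hlim
  filter_upwards [eventually_ge_atTop 0] with t ht
  refine le_trans (le_of_eq ?_) (energy_decay (u := u) hbp.le hA
    (fun i => (hh.continuousOn i).sub continuousOn_const)
    (fun s hs i => (hh.hasDerivAt hs i).sub_const (y i)) ht)
  exact Finset.sum_congr rfl fun i _ => by simp only [u]; ring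

end LimitEquation

end XavierRegression

/-! ### The theorem, by pathwise application of the deterministic results. -/

theorem mainTheorem5 {d M : ℕ} (σ : ℝ → ℝ)
    (hσ : XavierRegression.IsC2b σ)
    (hσ_np : XavierRegression.IsNonPolynomial σ)
    (hσ_slow : XavierRegression.IsSlowlyIncreasing σ)
    (μ₀ : Measure (ℝ × EuclideanSpace ℝ (Fin d))) [IsProbabilityMeasure μ₀]
    (B : ℝ) (hB : 0 < B) (hμ₀ : XavierRegression.HasFullSupportOnStrip B μ₀)
    (α : ℝ) (hα : 0 < α)
    (x : Fin M → EuclideanSpace ℝ (Fin d)) (y : Fin M → ℝ)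
    (hx : XavierRegression.InDistinctDirections x)
    {Ω : Type*} [MeasurableSpace Ω] (P : Measure Ω) [IsProbabilityMeasure P]
    (G : Ω → Fin M → ℝ) (hG : Measurable G) :
    -- the random limit equation has a solution,
    (∃ h : ℝ → Ω → EuclideanSpace ℝ (Fin d) → ℝ,
      (∀ t : ℝ, 0 ≤ t → ∀ i, Measurable fun ω => h t ω (x i)) ∧
      ∀ᵐ ω ∂P, XavierRegression.IsLimitSolution σ α μ₀ x y (G ω) (fun t => h t ω)) ∧
    -- the solution is unique,
    (∀ h h' : ℝ → Ω → EuclideanSpace ℝ (Fin d) → ℝ,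
      (∀ᵐ ω ∂P, XavierRegression.IsLimitSolution σ α μ₀ x y (G ω) (fun t => h t ω)) →
      (∀ᵐ ω ∂P, XavierRegression.IsLimitSolution σ α μ₀ x y (G ω) (fun t => h' t ω)) →
      ∀ᵐ ω ∂P, ∀ t : ℝ, 0 ≤ t → ∀ i, h t ω (x i) = h' t ω (x i)) ∧
    -- and it converges to the vector of targets; the training error tends to zero.
    (∀ h : ℝ → Ω → EuclideanSpace ℝ (Fin d) → ℝ,
      (∀ᵐ ω ∂P, XavierRegression.IsLimitSolution σ α μ₀ x y (G ω) (fun t => h t ω)) →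
      ∀ᵐ ω ∂P,
        Tendsto (fun t : ℝ => fun i : Fin M => h t ω (x i)) atTop (𝓝 y) ∧
        Tendsto (fun t : ℝ => ∫ z, (z.2 - h t ω z.1) ^ 2 ∂(XavierRegression.dataMeasure x y))
          atTop (𝓝 0)) := by
  obtain ⟨c, hc, hA⟩ := XavierRegression.exists_coercive (A := XavierRegression.kernelMatrix σ μ₀ x)
    fun v hv => XavierRegression.kernelMatrix_pos hσ hσ_np hB hμ₀ hx hv
  refine ⟨?_, fun h h' hh hh' => ?_, fun h hh => ?_⟩
  · obtain ⟨Φ, hΦ, hsol⟩ := XavierRegression.exists_limitSolution hx σ α μ₀ y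
    exact ⟨fun t ω => Φ t (G ω), fun t _ i => (hΦ t i).measurable.comp hG,
      .of_forall fun ω => hsol (G ω)⟩
  · filter_upwards [hh, hh'] with ω h₁ h₂ t ht i using h₁.unique hα hA h₂ ht i
  · filter_upwards [hh] with ω hω
    -- Without data the rate `α/M` degenerates to `0`, but both limits are trivial.
    obtain rfl | hM := M.eq_zero_or_pos
    · refine ⟨?_, by simp [XavierRegression.integral_dataMeasure]⟩
      exact tendsto_const_nhds.congr fun t => Subsingleton.elim _ _
    have hsq := hω.tendsto hα hA hM hc
    refine ⟨tendsto_pi_nhds.2 fun i => ?_, ?_⟩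
    · have hi : Tendsto (fun t => |y i - h t ω (x i)|) atTop (𝓝 0) := by
        refine squeeze_zero (fun t => abs_nonneg _) (fun t => ?_)
          (by simpa using (Real.continuous_sqrt.tendsto 0).comp hsq)
        exact Real.abs_le_sqrt (Finset.single_le_sum
          (f := fun i => (y i - h t ω (x i)) ^ 2) (fun _ _ => sq_nonneg _) (Finset.mem_univ i))
      simpa using ((tendsto_zero_iff_abs_tendsto_zero _).2 hi).const_sub (y i)
    · simp only [XavierRegression.integral_dataMeasure]
      simpa using hsq.const_mul (M : ℝ)⁻¹
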